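/- Let $S\subset\mathbb{R}^3$ be an embedded $C^\infty$ surface without boundary (for instance a compact real analytic one), with the Riemannian metric induced by $\mathbb{R}^3$, and let $b\in S$. Let $d_b$ be the Riemannian distance to $b$ in $S$, and let the cut locus $Cut_b(S)$ be the closure in $S$ of the set of points of $S$ that are joined to $b$ by at least two minimizing geodesics. For $x\in S\setminus\{b\}$ in the same connected component of $S$ as $b$, the norm of the generalized gradient of $d_b$ at $x$ is $$|\nabla_S d_b|(x)=\max\Big(0,\ \sup_{v\in T_xS,\ |v|=1}\partial_v^+d_b(x)\Big),\qquad \partial_v^+d_b(x)=\limsup_{t\to0^+}\frac{d_b(\exp_x(tv))-d_b(x)}{t},$$ where $\exp_x$ is the Riemannian exponential map of $S$ at $x$ (the upper limit is in fact a limit). Let $x\in Cut_b(S)$, and let $\gamma_1,\gamma_2:[0,d_b(x)]\to S$ be two unit-speed minimizing geodesics with $\gamma_i(0)=b$ and $\gamma_i(d_b(x))=x$ for $i=1,2$. Suppose that the angle $\theta$ between $\gamma_1$ and $\gamma_2$ at $x$, that is, the angle between the vectors $-\dot\gamma_1(d_b(x))$ and $-\dot\gamma_2(d_b(x))$, lies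 in $(0,\pi)$. Then $$|\nabla_S d_b|(x)\le\cos(\theta/2).$$ -/

import Mathlib

open Set Filter Topology MeasureTheory
open scoped ContDiff

noncomputable section

namespace CutLocus

/-- Euclidean three-space. -/
abbrev E3 := EuclideanSpace ℝ (Fin 3)

/-- `S` is an embedded surface without boundary in `ℝ³`, of class `C^n` (`n = ∞`: smooth,
`n = ω`: real analytic): around each of its points there is a `C^n` diffeomorphism between open
subsets of `ℝ³` that straightens `S` to the coordinate plane `{q | q 2 = 0}`. -/
def IsSurface (n : WithTop ℕ∞) (S : Set E3) : Prop :=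
  ∀ p ∈ S, ∃ Φ : OpenPartialHomeomorph E3 E3,
    p ∈ Φ.source ∧ ContDiffOn ℝ n Φ Φ.source ∧ ContDiffOn ℝ n Φ.symm Φ.target ∧
      ∀ q ∈ Φ.source, q ∈ S ↔ Φ q 2 = 0

/-- The tangent space `T_p S`: velocities at `p` of smooth curves in `S` through `p`. -/
def tangentSet (S : Set E3) (p : E3) : Set E3 :=
  {v | ∃ c : ℝ → E3, ContDiffAt ℝ ∞ c 0 ∧ (∀ᶠ t in 𝓝 0, c t ∈ S) ∧ c 0 = p ∧ deriv c 0 = v}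

/-- The Riemannian distance of `S` for the metric induced by `ℝ³`, with values in `[0, ∞]`: the
infimum of the lengths of the `C¹` curves in `S` from `p` to `q`. -/
def surfaceEDist (S : Set E3) (p q : E3) : ENNReal :=
  ⨅ (c : ℝ → E3) (_ : ContDiffOn ℝ 1 c (Icc 0 1) ∧ (∀ t ∈ Icc (0 : ℝ) 1, c t ∈ S) ∧
      c 0 = p ∧ c 1 = q),
    ∫⁻ t in Icc (0 : ℝ) 1, ‖derivWithin c (Icc 0 1) t‖ₑ

/-- The distance `d_b(x)` in `S` as a real number; it is only used for points in the same
component of `S`, where `surfaceEDist` is finite. -/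
def surfaceDist (S : Set E3) (b x : E3) : ℝ := (surfaceEDist S b x).toReal

/-- The velocity at time `t` of a curve defined on `[0, L]` (one-sided at the end points). -/
def velocity (L : ℝ) (c : ℝ → E3) (t : ℝ) : E3 := derivWithin c (Icc 0 L) t

/-- `c : [0, L] → S` is a geodesic of `S`: its acceleration in `ℝ³` is normal to `S`, that is, the
covariant derivative of its velocity vanishes. -/
def IsGeodesic (S : Set E3) (L : ℝ) (c : ℝ → E3) : Prop :=
  ContDiffOn ℝ 2 c (Icc 0 L) ∧ ∀ t ∈ Icc 0 L, c t ∈ S ∧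
    ∀ w ∈ tangentSet S (c t), inner ℝ (derivWithin (velocity L c) (Icc 0 L) t) w = 0

/-- `c : [0, d_b(x)] → S` is a unit-speed minimizing geodesic from `b` to `x`. It is minimizing
since its length is the length `d_b(x)` of its interval of definition. The unit speed condition
forces `0 < d_b(x)`, as `derivWithin` vanishes on a one-point interval. -/
def IsUnitSpeedMinGeodesic (S : Set E3) (b x : E3) (c : ℝ → E3) : Prop :=
  IsGeodesic S (surfaceDist S b x) c ∧
    (∀ t ∈ Icc 0 (surfaceDist S b x), ‖velocity (surfaceDist S b x) c t‖ = 1) ∧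
    c 0 = b ∧ c (surfaceDist S b x) = x

/-- The cut locus `Cut_b(S)`: the closure in `S` of the set of points of `S` that are joined to
`b` by at least two minimizing geodesics. -/
def cutLocus (S : Set E3) (b : E3) : Set E3 :=
  S ∩ closure {p | p ∈ S ∧ ∃ c₁ c₂ : ℝ → E3,
    IsUnitSpeedMinGeodesic S b p c₁ ∧ IsUnitSpeedMinGeodesic S b p c₂ ∧
      ¬ EqOn c₁ c₂ (Icc 0 (surfaceDist S b p))}

open Classical in
/-- The Riemannian exponential map `exp_x` of `S`: the value at time `1` of the geodesic with
initial point `x` and initial velocity `w` (with the default value `x` where there is no such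
geodesic on `[0, 1]`, which does not happen for small tangent vectors `w`). -/
def expMap (S : Set E3) (x w : E3) : E3 :=
  if h : ∃ c : ℝ → E3, IsGeodesic S 1 c ∧ c 0 = x ∧ velocity 1 c 0 = w then h.choose 1 else x

/-- The one-sided directional derivative `∂⁺_v f(x)` along `t ↦ exp_x(t v)`, as an upper limit in
the extended reals, which is the limit whenever the limit exists. -/
def dirDeriv (S : Set E3) (f : E3 → ℝ) (x v : E3) : EReal :=
  limsup (fun t : ℝ => (((f (expMap S x (t • v)) - f x) / t : ℝ) : EReal)) (𝓝[>] 0)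

/-- The norm of the generalized gradient of `f` on `S` at `x`:
`max(0, sup {∂⁺_v f(x) : v ∈ T_x S, |v| = 1})`. -/
def genGradNorm (S : Set E3) (f : E3 → ℝ) (x : E3) : EReal :=
  max 0 (⨆ v ∈ {v : E3 | v ∈ tangentSet S x ∧ ‖v‖ = 1}, dirDeriv S f x v)

end CutLocus

end

/-! ### Lengths of curves and the distance of `S` -/

noncomputable section

namespace CutLocus

open scoped Manifold
open Manifold (pathELength)

attribute [local instance] normedAddCommGroupTangentSpaceVectorSpace
attribute [local instance] normedSpaceTangentSpaceVectorSpace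

/-! Let `u₁`, `u₂` be the final velocities of the two geodesics. A single minimizing geodesic with
final velocity `u` bounds the growth of the distance in a unit direction `v` by roughly `⟪u, v⟫`,
since following it and cutting the corner near `x` gives a competing curve. With two geodesics the
better one can be chosen for each `v`: as `‖u₁ + u₂‖ = 2 cos (θ/2)`, Cauchy–Schwarz forces one of
the `⟪uᵢ, v⟫` to be at most `cos (θ/2)`.

The corner is cut quantitatively in `IsUnitSpeedMinGeodesic.eventually_quotient_le`: leave `γ` at
time `L - K t`, where `L` is the distance from `b` to `x`, and go directly to `exp_x(t v)`. For
large `K` the chord has length about `t ‖K u + v‖`, close to `t (K + ⟪u, v⟫)`. Two extrinsic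
estimates make this rigorous: `exists_norm_geodesic_sub_le` (geodesics from `x` are straight to
second order) and `eventually_surfaceEDist_le` (distance in `S` is locally almost chordal). No
smoothness of the exponential map is needed. -/

/-- The length of a curve, written with `derivWithin`, is its length in the sense of Mathlib. -/
lemma lintegral_enorm_derivWithin_eq_pathELength (c : ℝ → E3) (a b : ℝ) :
    ∫⁻ t in Icc a b, ‖derivWithin c (Icc a b) t‖ₑ = pathELength 𝓘(ℝ, E3) c a b := by
  rw [Manifold.pathELength_eq_lintegral_mfderivWithin_Icc]
  simp only [mfderivWithin_eq_fderivWithin]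
  rfl

/-- The distance is at most the length of any `C¹` curve in `S`, on any interval. -/
lemma surfaceEDist_le_pathELength {S : Set E3} {a b : ℝ} (hab : a ≤ b) {c : ℝ → E3}
    (hc : ContDiffOn ℝ 1 c (Icc a b)) (hcS : ∀ t ∈ Icc a b, c t ∈ S) :
    surfaceEDist S (c a) (c b) ≤ pathELength 𝓘(ℝ, E3) c a b := by
  set η : ℝ → ℝ := fun t => a + t * (b - a) with hη
  have hmaps : MapsTo η (Icc 0 1) (Icc a b) := by
    intro t ht
    constructor <;> simp only [hη] <;> nlinarith [ht.1, ht.2]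
  have h0 : η 0 = a := by simp [hη]
  have h1 : η 1 = b := by simp [hη]
  have hηs : ContDiff ℝ 1 η := by simp only [hη]; fun_prop
  have hmono : MonotoneOn η (Icc 0 1) := by
    intro s _ t _ hst
    simp only [hη]
    nlinarith
  have hle : surfaceEDist S (c a) (c b) ≤ pathELength 𝓘(ℝ, E3) (c ∘ η) 0 1 := by
    rw [← lintegral_enorm_derivWithin_eq_pathELength]
    exact iInf₂_le _ ⟨hc.comp hηs.contDiffOn hmaps, fun t ht => hcS _ (hmaps ht),
      by simp [h0], by simp [h1]⟩
  rwa [Manifold.pathELength_comp_of_monotoneOn zero_le_one hmono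
    (hηs.contDiffOn.differentiableOn one_ne_zero), h0, h1] at hle
  rw [h0, h1]
  exact (hc.differentiableOn one_ne_zero).mdifferentiableOn

/-- Nearly minimizing curves may be taken locally constant near both ends. -/
lemma exists_locally_constant_of_surfaceEDist_lt {S : Set E3} {p q : E3} {r : ENNReal}
    (hr : surfaceEDist S p q < r) {a b : ℝ} (hab : a < b) :
    ∃ c : ℝ → E3, c a = p ∧ c b = q ∧ ContDiff ℝ 1 c ∧ (∀ t, c t ∈ S) ∧
      pathELength 𝓘(ℝ, E3) c a b < r ∧ c =ᶠ[𝓝 a] (fun _ => p) ∧ c =ᶠ[𝓝 b] (fun _ => q) := by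
  simp only [surfaceEDist, iInf_lt_iff, exists_prop] at hr
  obtain ⟨γ, ⟨hγ, hγS, hγ0, hγ1⟩, hlen⟩ := hr
  rw [lintegral_enorm_derivWithin_eq_pathELength] at hlen
  obtain ⟨a', haa', ha'b⟩ := exists_between hab
  obtain ⟨b', ha'b', hb'b⟩ := exists_between ha'b
  -- A monotone reparametrization, constant before `a'` and after `b'`, keeps the length.
  let η (t : ℝ) : ℝ := Real.smoothTransition ((b' - a')⁻¹ * (t - a'))
  have hη01 (t) : η t ∈ Icc (0 : ℝ) 1 :=
    ⟨Real.smoothTransition.nonneg _, Real.smoothTransition.le_one _⟩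
  have hηs : ContDiff ℝ 1 η := by simp only [η]; fun_prop
  have A (t) (ht : t < a') : η t = 0 := by
    simp only [η, Real.smoothTransition.zero_iff_nonpos]
    apply mul_nonpos_of_nonneg_of_nonpos
    · simpa using ha'b'.le
    · linarith
  have B (t) (ht : b' < t) : η t = 1 := by
    simp only [η, Real.smoothTransition.eq_one_iff_one_le, inv_mul_eq_div]
    rw [one_le_div₀] <;> linarith
  refine ⟨γ ∘ η, by simp [A a haa', hγ0], by simp [B b hb'b, hγ1], ?_, fun t => hγS _ (hη01 t),
    ?_, ?_, ?_⟩
  · rw [← contDiffOn_univ]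
    exact hγ.comp hηs.contDiffOn (fun t _ => hη01 t)
  · convert! hlen using 1
    rw [← A a haa', ← B b hb'b]
    apply Manifold.pathELength_comp_of_monotoneOn hab.le
    · apply Monotone.monotoneOn
      apply Real.smoothTransition.monotone.comp
      intro t u htu
      dsimp only
      gcongr
    · exact hηs.contDiffOn.differentiableOn one_ne_zero
    · rw [A a haa', B b hb'b]
      exact (hγ.differentiableOn one_ne_zero).mdifferentiableOn
  · filter_upwards [Iio_mem_nhds haa'] with t ht
    simp [A t ht, hγ0]
  · filter_upwards [Ioi_mem_nhds hb'b] with t ht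
    simp [B t ht, hγ1]

/-- The triangle inequality for the Riemannian distance of `S`. -/
lemma surfaceEDist_triangle (S : Set E3) (p q r : E3) :
    surfaceEDist S p r ≤ surfaceEDist S p q + surfaceEDist S q r := by
  apply le_of_forall_gt (fun ρ hρ => ?_)
  obtain ⟨u, hu, v, hv, huv⟩ := ENNReal.exists_add_lt_of_add_lt hρ
  obtain ⟨γ₁, hγ₁0, hγ₁1, hγ₁s, hγ₁S, hγ₁, -, hγ₁c⟩ :=
    exists_locally_constant_of_surfaceEDist_lt hu zero_lt_one
  obtain ⟨γ₂, hγ₂1, hγ₂2, hγ₂s, hγ₂S, hγ₂, hγ₂c, -⟩ :=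
    exists_locally_constant_of_surfaceEDist_lt hv one_lt_two
  let γ := piecewise (Iic 1) γ₁ γ₂
  have hγs : ContDiff ℝ 1 γ := by
    rw [← contMDiff_iff_contDiff]
    -- Both pieces are constantly `q` near time `1`, so the concatenation has no corner there.
    exact ContMDiff.piecewise_Iic (contMDiff_iff_contDiff.2 hγ₁s) (contMDiff_iff_contDiff.2 hγ₂s)
      (hγ₁c.trans hγ₂c.symm)
  have hle : surfaceEDist S (γ 0) (γ 2) ≤ pathELength 𝓘(ℝ, E3) γ 0 2 := by
    refine surfaceEDist_le_pathELength zero_le_two hγs.contDiffOn fun t _ => ?_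
    by_cases ht : t ≤ 1
    · simpa [γ, ht] using hγ₁S t
    · simpa [γ, ht] using hγ₂S t
  have h0 : γ 0 = p := by simp [γ, hγ₁0]
  have h2 : γ 2 = r := by simp [γ, hγ₂2]
  rw [h0, h2] at hle
  refine hle.trans_lt (lt_trans ?_ huv)
  rw [← Manifold.pathELength_add zero_le_one one_le_two]
  gcongr
  · convert! hγ₁ using 1
    apply Manifold.pathELength_congr
    intro t ht
    simp [γ, ht.2]
  · convert! hγ₂ using 1
    apply Manifold.pathELength_congr_Ioo
    intro t ht
    simp [γ, ht.1]

/-- A `C¹` curve in `S` of speed at most `v` on `[a, b]` joins points at distance at most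
`v (b - a)`. -/
lemma surfaceEDist_le_of_norm_derivWithin_le {S : Set E3} {a b v : ℝ} (hab : a ≤ b) {c : ℝ → E3}
    (hc : ContDiffOn ℝ 1 c (Icc a b)) (hcS : ∀ t ∈ Icc a b, c t ∈ S)
    (hv : ∀ t ∈ Icc a b, ‖derivWithin c (Icc a b) t‖ ≤ v) :
    surfaceEDist S (c a) (c b) ≤ ENNReal.ofReal (v * (b - a)) := by
  have hv0 : 0 ≤ v := (norm_nonneg _).trans (hv a ⟨le_rfl, hab⟩)
  refine (surfaceEDist_le_pathELength hab hc hcS).trans ?_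
  rw [← lintegral_enorm_derivWithin_eq_pathELength]
  calc ∫⁻ t in Icc a b, ‖derivWithin c (Icc a b) t‖ₑ
      ≤ ∫⁻ _ in Icc a b, ENNReal.ofReal v := by
        refine setLIntegral_mono measurable_const fun t ht => ?_
        rw [← ofReal_norm]
        exact ENNReal.ofReal_le_ofReal (hv t ht)
    _ = ENNReal.ofReal (v * (b - a)) := by
        rw [setLIntegral_const, Real.volume_Icc, ENNReal.ofReal_mul hv0]

end CutLocus

end

/-! ### Local defining functions and normal vectors -/

noncomputable section

namespace CutLocus

/-- The coordinate-plane condition is preserved along segments. -/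
lemma lineMap_apply_two_eq_zero {P Q : E3} (hP : P 2 = 0) (hQ : Q 2 = 0) (t : ℝ) :
    (P + t • (Q - P)) 2 = 0 := by
  simp [hP, hQ]

/-- Near each of its points a surface is the zero set of a smooth function without critical
points, and the kernel of the differential consists of tangent vectors. -/
lemma IsSurface.exists_definingFunction {n : WithTop ℕ∞} (hn : ∞ ≤ n) {S : Set E3}
    (hS : IsSurface n S) {p : E3} (hp : p ∈ S) :
    ∃ (U : Set E3) (F : E3 → ℝ), IsOpen U ∧ p ∈ U ∧ ContDiffOn ℝ ∞ F U ∧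
      ∀ q ∈ U, fderiv ℝ F q ≠ 0 ∧ (q ∈ S → F q = 0 ∧
        ∀ v, fderiv ℝ F q v = 0 → v ∈ tangentSet S q) := by
  obtain ⟨Φ, hpΦ, hΦ, hΨ, hiff⟩ := hS p hp
  replace hΦ := hΦ.of_le hn
  replace hΨ := hΨ.of_le hn
  let π : E3 →L[ℝ] ℝ := EuclideanSpace.proj 2
  refine ⟨Φ.source, fun q => Φ q 2, Φ.open_source, hpΦ,
    π.contDiff.comp_contDiffOn hΦ, fun q hq => ?_⟩
  have hΦq : HasFDerivAt Φ (fderiv ℝ Φ q) q :=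
    ((hΦ.contDiffAt (Φ.open_source.mem_nhds hq)).differentiableAt (by simp)).hasFDerivAt
  have hqt : Φ q ∈ Φ.target := Φ.map_source hq
  have hΨc : ContDiffAt ℝ ∞ Φ.symm (Φ q) := hΨ.contDiffAt (Φ.open_target.mem_nhds hqt)
  have hΨq : HasFDerivAt Φ.symm (fderiv ℝ Φ.symm (Φ q)) (Φ q) :=
    (hΨc.differentiableAt (by simp)).hasFDerivAt
  have hF : HasFDerivAt (fun q => Φ q 2) (π.comp (fderiv ℝ Φ q)) q := π.hasFDerivAt.comp q hΦq
  have hΨΦ : (fderiv ℝ Φ.symm (Φ q)).comp (fderiv ℝ Φ q) = ContinuousLinearMap.id ℝ E3 := by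
    refine (hΨq.comp q hΦq).unique ((hasFDerivAt_id q).congr_of_eventuallyEq ?_)
    filter_upwards [Φ.open_source.mem_nhds hq] with z hz using Φ.left_inv hz
  have hΦΨ : (fderiv ℝ Φ q).comp (fderiv ℝ Φ.symm (Φ q)) = ContinuousLinearMap.id ℝ E3 := by
    have hΦq' : HasFDerivAt Φ (fderiv ℝ Φ q) (Φ.symm (Φ q)) := by rwa [Φ.left_inv hq]
    refine (hΦq'.comp (Φ q) hΨq).unique ((hasFDerivAt_id (Φ q)).congr_of_eventuallyEq ?_)
    filter_upwards [Φ.open_target.mem_nhds hqt] with z hz using Φ.right_inv hz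
  rw [hF.fderiv]
  refine ⟨fun h0 => ?_, fun hqS => ⟨(hiff q hq).1 hqS, fun v hv => ?_⟩⟩
  -- The differential of `Φ` has a right inverse, so it reaches the third basis vector, where the
  -- coordinate `π` is `1`.
  · have h1 := DFunLike.congr_fun hΦΨ (EuclideanSpace.single 2 (1 : ℝ))
    have h2 := DFunLike.congr_fun h0
      (fderiv ℝ Φ.symm (Φ q) (EuclideanSpace.single 2 (1 : ℝ)))
    simp only [ContinuousLinearMap.comp_apply, ContinuousLinearMap.id_apply] at h1 h2
    rw [h1] at h2
    simp [π] at h2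
  · have hv2 : (fderiv ℝ Φ q v) 2 = 0 := hv
    have hline : HasDerivAt (fun t : ℝ => Φ q + t • fderiv ℝ Φ q v) (fderiv ℝ Φ q v) 0 := by
      simpa using ((hasDerivAt_id (0 : ℝ)).smul_const (fderiv ℝ Φ q v)).const_add (Φ q)
    have hline0 : Φ q + (0 : ℝ) • fderiv ℝ Φ q v = Φ q := by simp
    -- In the chart, the line through `Φ q` in the direction of the image of `v` stays in the
    -- coordinate plane; its pullback is a curve in `S` with velocity `v`.
    refine ⟨fun t => Φ.symm (Φ q + t • fderiv ℝ Φ q v), ?_, ?_, ?_, ?_⟩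
    · refine ContDiffAt.comp (0 : ℝ) (g := Φ.symm) ?_ ?_
      · rwa [hline0]
      · fun_prop
    · have ht : ∀ᶠ t : ℝ in 𝓝 0, Φ q + t • fderiv ℝ Φ q v ∈ Φ.target := by
        refine hline.continuousAt.eventually_mem (Φ.open_target.mem_nhds ?_)
        rwa [hline0]
      filter_upwards [ht] with t ht
      rw [hiff _ (Φ.map_target ht), Φ.right_inv ht]
      simp [(hiff q hq).1 hqS, hv2]
    · simp [Φ.left_inv hq]
    · have := hΨq.comp_hasDerivAt_of_eq (0 : ℝ) hline hline0.symm
      refine this.deriv.trans ?_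
      exact DFunLike.congr_fun hΨΦ v

/-- A vector orthogonal to the kernel of a nonzero functional has its norm controlled by the
value of the functional. -/
lemma norm_mul_norm_le_of_orthogonal_ker {V : Type*} [NormedAddCommGroup V]
    [InnerProductSpace ℝ V] [CompleteSpace V] (G : V →L[ℝ] ℝ) (a : V)
    (ha : ∀ w, G w = 0 → inner ℝ a w = 0) : ‖G‖ * ‖a‖ ≤ ‖G a‖ := by
  set ν : V := (InnerProductSpace.toDual ℝ V).symm G with hν
  have hG (w : V) : G w = inner ℝ ν w := by simp [hν]
  have hnorm : ‖G‖ = ‖ν‖ := by simp [hν]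
  rcases eq_or_ne ν 0 with h0 | h0
  · simp [hnorm, h0]
  have hνν : inner ℝ ν ν ≠ 0 := by simpa using h0
  -- The component `w` of `a` orthogonal to `ν` lies in the kernel, so it is orthogonal to both `a`
  -- and `ν`, hence to itself.
  set w : V := a - (inner ℝ ν a / inner ℝ ν ν) • ν with hw
  have hGw : inner ℝ ν w = 0 := by
    rw [hw, inner_sub_right, inner_smul_right, div_mul_cancel₀ _ hνν, sub_self]
  have hw0 : w = 0 := by
    rw [← inner_self_eq_zero (𝕜 := ℝ)]
    nth_rewrite 1 [hw]
    rw [inner_sub_left, inner_smul_left, hGw, ha w ((hG w).trans hGw)]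
    simp
  have hav : a = (inner ℝ ν a / inner ℝ ν ν) • ν := sub_eq_zero.1 hw0
  rw [hnorm, hG]
  nth_rewrite 1 [hav]
  rw [norm_smul, real_inner_self_eq_norm_sq, norm_div, norm_pow, norm_norm]
  have : ‖ν‖ ≠ 0 := norm_ne_zero_iff.2 h0
  apply le_of_eq
  field_simp

/-! ### Speed and acceleration of geodesics -/

section Geodesic

variable {S : Set E3} {L : ℝ} {c : ℝ → E3}

lemma IsGeodesic.hasDerivWithinAt (hc : IsGeodesic S L c) {t : ℝ} (ht : t ∈ Icc 0 L) :
    HasDerivWithinAt c (velocity L c t) (Icc 0 L) t :=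
  (hc.1.differentiableOn (by norm_num) t ht).hasDerivWithinAt

lemma IsGeodesic.hasDerivWithinAt_velocity (hc : IsGeodesic S L c) (hL : 0 < L) {t : ℝ}
    (ht : t ∈ Icc 0 L) :
    HasDerivWithinAt (velocity L c) (derivWithin (velocity L c) (Icc 0 L) t) (Icc 0 L) t := by
  have h : ContDiffOn ℝ 1 (derivWithin c (Icc 0 L)) (Icc 0 L) :=
    hc.1.derivWithin (uniqueDiffOn_Icc hL) (by norm_num)
  exact (h.differentiableOn one_ne_zero t ht).hasDerivWithinAt

variable {U : Set E3} {F : E3 → ℝ}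

/-- The velocity of a curve in `S` is annihilated by the differential of a defining function. -/
lemma IsGeodesic.fderiv_velocity_eq_zero (hc : IsGeodesic S L c) (hL : 0 < L) (hU : IsOpen U)
    (hF : ContDiffOn ℝ ∞ F U) (hFS : ∀ q ∈ U, q ∈ S → F q = 0) {t : ℝ} (ht : t ∈ Icc 0 L)
    (htU : c t ∈ U) : fderiv ℝ F (c t) (velocity L c t) = 0 := by
  have hFd : HasFDerivAt F (fderiv ℝ F (c t)) (c t) :=
    ((hF.contDiffAt (hU.mem_nhds htU)).differentiableAt (by simp)).hasFDerivAt
  have hcomp := hFd.comp_hasDerivWithinAt t (hc.hasDerivWithinAt ht)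
  refine (uniqueDiffOn_Icc hL t ht).eq_deriv _ hcomp ?_
  refine (hasDerivWithinAt_const t (Icc 0 L) (0 : ℝ)).congr_of_eventuallyEq ?_
    (hFS _ htU (hc.2 t ht).1)
  filter_upwards [(hc.hasDerivWithinAt ht).continuousWithinAt.eventually_mem (hU.mem_nhds htU),
    self_mem_nhdsWithin] with s hs hsI using hFS _ hs (hc.2 s hsI).1

/-- The normal component of the acceleration of a curve in `S`. -/
lemma IsGeodesic.fderiv_acceleration_eq (hc : IsGeodesic S L c) (hL : 0 < L) (hU : IsOpen U)
    (hF : ContDiffOn ℝ ∞ F U) (hFS : ∀ q ∈ U, q ∈ S → F q = 0) {t : ℝ} (ht : t ∈ Icc 0 L)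
    (htU : c t ∈ U) :
    fderiv ℝ (fderiv ℝ F) (c t) (velocity L c t) (velocity L c t) +
      fderiv ℝ F (c t) (derivWithin (velocity L c) (Icc 0 L) t) = 0 := by
  have hFd : HasFDerivAt (fderiv ℝ F) (fderiv ℝ (fderiv ℝ F) (c t)) (c t) := by
    have h1 : ContDiffAt ℝ 1 (fderiv ℝ F) (c t) :=
      (hF.contDiffAt (hU.mem_nhds htU)).fderiv_right (by norm_cast)
    exact (h1.differentiableAt one_ne_zero).hasFDerivAt
  have hcomp := (hFd.comp_hasDerivWithinAt t (hc.hasDerivWithinAt ht)).clm_apply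
    (hc.hasDerivWithinAt_velocity hL ht)
  refine (uniqueDiffOn_Icc hL t ht).eq_deriv _ hcomp ?_
  refine (hasDerivWithinAt_const t (Icc 0 L) (0 : ℝ)).congr_of_eventuallyEq ?_
    (hc.fderiv_velocity_eq_zero hL hU hF hFS ht htU)
  filter_upwards [(hc.hasDerivWithinAt ht).continuousWithinAt.eventually_mem (hU.mem_nhds htU),
    self_mem_nhdsWithin] with s hs hsI using hc.fderiv_velocity_eq_zero hL hU hF hFS hsI hs

/-- Geodesics have constant speed. -/
lemma IsGeodesic.norm_velocity_eq {n : WithTop ℕ∞} (hn : ∞ ≤ n) (hS : IsSurface n S)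
    (hc : IsGeodesic S L c) (hL : 0 < L) {t : ℝ} (ht : t ∈ Icc 0 L) :
    ‖velocity L c t‖ = ‖velocity L c 0‖ := by
  have hd (s) (hs : s ∈ Icc 0 L) : HasDerivWithinAt (fun s => ‖velocity L c s‖ ^ 2) 0
      (Icc 0 L) s := by
    obtain ⟨U, F, hU, hsU, hF, hUF⟩ := hS.exists_definingFunction hn (hc.2 s hs).1
    have hvel : velocity L c s ∈ tangentSet S (c s) :=
      ((hUF _ hsU).2 (hc.2 s hs).1).2 _ (hc.fderiv_velocity_eq_zero hL hU hF
        (fun q hq hqS => ((hUF q hq).2 hqS).1) hs hsU)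
    -- The derivative of the squared speed is twice the product of the velocity, which is tangent,
    -- with the acceleration, which is normal.
    have h := (hc.hasDerivWithinAt_velocity hL hs).norm_sq
    rwa [real_inner_comm, (hc.2 s hs).2 _ hvel, mul_zero] at h
  have hconst := constant_of_derivWithin_zero (f := fun s => ‖velocity L c s‖ ^ 2)
    (fun s hs => (hd s hs).differentiableWithinAt)
    (fun s hs => (hd s ⟨hs.1, hs.2.le⟩).derivWithin (uniqueDiffOn_Icc hL s ⟨hs.1, hs.2.le⟩)) t ht
  exact (sq_eq_sq₀ (norm_nonneg _) (norm_nonneg _)).1 hconst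

/-- Short geodesics issued from `x` agree with straight segments up to second order, uniformly. -/
lemma IsSurface.exists_norm_geodesic_sub_le {n : WithTop ℕ∞} (hn : ∞ ≤ n) (hS : IsSurface n S)
    {x : E3} (hx : x ∈ S) :
    ∃ C > 0, ∃ r > 0, ∀ c : ℝ → E3, IsGeodesic S 1 c → c 0 = x → ‖velocity 1 c 0‖ < r →
      ‖c 1 - x - velocity 1 c 0‖ ≤ C * ‖velocity 1 c 0‖ ^ 2 := by
  obtain ⟨U, F, hU, hxU, hF, hUF⟩ := hS.exists_definingFunction hn hx
  have hFx : ContDiffAt ℝ ∞ F x := hF.contDiffAt (hU.mem_nhds hxU)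
  have hG : ContDiffAt ℝ 1 (fderiv ℝ F) x := hFx.fderiv_right (by norm_cast)
  have hH : ContinuousAt (fderiv ℝ (fderiv ℝ F)) x :=
    (hG.fderiv_right (m := 0) (by norm_num)).continuousAt
  set m : ℝ := ‖fderiv ℝ F x‖ / 2 with hm
  have hGx : 0 < ‖fderiv ℝ F x‖ := norm_pos_iff.2 (hUF x hxU).1
  have hm0 : 0 < m := by positivity
  set M : ℝ := ‖fderiv ℝ (fderiv ℝ F) x‖ + 1 with hM
  have hM0 : 0 < M := by positivity
  have hGev : ∀ᶠ q in 𝓝 x, m < ‖fderiv ℝ F q‖ :=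
    continuousAt_const.eventually_lt hG.continuousAt.norm (half_lt_self hGx)
  have hHn : ContinuousAt (fun q => ‖fderiv ℝ (fderiv ℝ F) q‖) x :=
    ContinuousAt.norm (E := E3 →L[ℝ] E3 →L[ℝ] ℝ) hH
  have hHev : ∀ᶠ q in 𝓝 x, ‖fderiv ℝ (fderiv ℝ F) q‖ < M :=
    hHn.eventually_lt continuousAt_const (lt_add_one _)
  have hev := (hU.eventually_mem hxU).and (hGev.and hHev)
  obtain ⟨r, hr, hball⟩ := Metric.eventually_nhds_iff.1 hev
  -- Near `x`, `‖F'‖ > m` and `‖F''‖ < M`. A normal acceleration then satisfies `m ‖c''‖ ≤ ‖F'(c'')‖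
  -- = ‖F''(c', c')‖ ≤ M ‖w‖ ^ 2`; integrating twice gives the claim.
  refine ⟨M / m, by positivity, r, hr, fun c hc hc0 hcr => ?_⟩
  set w := velocity 1 c 0 with hw
  have hspeed (t) (ht : t ∈ Icc (0 : ℝ) 1) : ‖velocity 1 c t‖ = ‖w‖ :=
    hc.norm_velocity_eq hn hS one_pos ht
  have h01 : (0 : ℝ) ∈ Icc (0 : ℝ) 1 := by simp
  -- Constant speed below `r` keeps the whole geodesic in the ball where these bounds hold.
  have hdist (t) (ht : t ∈ Icc (0 : ℝ) 1) : dist (c t) x < r := by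
    have h := Convex.norm_image_sub_le_of_norm_hasDerivWithin_le
      (fun s hs => hc.hasDerivWithinAt hs) (fun s hs => (hspeed s hs).le) (convex_Icc 0 1) h01 ht
    rw [hc0, sub_zero, Real.norm_of_nonneg ht.1] at h
    rw [dist_eq_norm]
    nlinarith [norm_nonneg w, ht.1, ht.2]
  have hacc (t) (ht : t ∈ Icc (0 : ℝ) 1) :
      ‖derivWithin (velocity 1 c) (Icc 0 1) t‖ ≤ M / m * ‖w‖ ^ 2 := by
    obtain ⟨htU, hmt, hMt⟩ := hball (hdist t ht)
    have heq := hc.fderiv_acceleration_eq one_pos hU hF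
      (fun q hq hqS => ((hUF q hq).2 hqS).1) ht htU
    have hle := norm_mul_norm_le_of_orthogonal_ker (fderiv ℝ F (c t))
      (derivWithin (velocity 1 c) (Icc 0 1) t)
      (fun v hv => (hc.2 t ht).2 v (((hUF _ htU).2 (hc.2 t ht).1).2 v hv))
    rw [← neg_eq_iff_add_eq_zero.2 heq, norm_neg] at hle
    have hle2 := (fderiv ℝ (fderiv ℝ F) (c t)).le_opNorm₂ (velocity 1 c t) (velocity 1 c t)
    rw [hspeed t ht] at hle2
    rw [div_mul_eq_mul_div, le_div_iff₀ hm0]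
    nlinarith [norm_nonneg (derivWithin (velocity 1 c) (Icc 0 1) t), sq_nonneg ‖w‖]
  have hvel (t) (ht : t ∈ Icc (0 : ℝ) 1) : ‖velocity 1 c t - w‖ ≤ M / m * ‖w‖ ^ 2 := by
    have h := Convex.norm_image_sub_le_of_norm_hasDerivWithin_le
      (fun s hs => hc.hasDerivWithinAt_velocity one_pos hs) hacc (convex_Icc 0 1) h01 ht
    refine h.trans (mul_le_of_le_one_right (by positivity) ?_)
    rw [sub_zero, Real.norm_of_nonneg ht.1]
    exact ht.2
  have hfin := Convex.norm_image_sub_le_of_norm_hasDerivWithin_le (f := fun t => c t - t • w)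
    (fun s hs => (hc.hasDerivWithinAt hs).sub
      ((hasDerivWithinAt_id s (Icc (0 : ℝ) 1)).smul_const w))
    (fun s hs => by simpa using hvel s hs) (convex_Icc 0 1) h01
    (show (1 : ℝ) ∈ Icc (0 : ℝ) 1 by simp)
  simp only [hc0, one_smul, zero_smul, sub_zero, norm_one, mul_one] at hfin
  rwa [sub_right_comm]

end Geodesic

/-! ### Comparison of the distance in `S` with the chordal distance -/

/-- Locally, the Riemannian distance of a surface is at most `1 + ε` times the chordal
distance. -/
lemma IsSurface.eventually_surfaceEDist_le {n : WithTop ℕ∞} (hn : ∞ ≤ n) {S : Set E3}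
    (hS : IsSurface n S) {x : E3} (hx : x ∈ S) {ε : ℝ} (hε : 0 < ε) :
    ∃ r > 0, ∀ p ∈ S, ∀ q ∈ S, dist p x < r → dist q x < r →
      surfaceEDist S p q ≤ ENNReal.ofReal ((1 + ε) * ‖q - p‖) := by
  obtain ⟨Φ, hxΦ, hΦ, hΨ, hiff⟩ := hS x hx
  replace hΦ := hΦ.of_le hn
  replace hΨ := hΨ.of_le hn
  have hxt : Φ x ∈ Φ.target := Φ.map_source hxΦ
  have hΦx : ContDiffAt ℝ ∞ Φ x := hΦ.contDiffAt (Φ.open_source.mem_nhds hxΦ)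
  have hΨx : ContDiffAt ℝ ∞ Φ.symm (Φ x) := hΨ.contDiffAt (Φ.open_target.mem_nhds hxt)
  obtain ⟨K, V, hV, hK⟩ := (hΦx.hasStrictFDerivAt (by simp)).exists_lipschitzOnWith
  set A := fderiv ℝ Φ.symm (Φ x) with hA
  -- The competing curve is the pullback of the segment from `P` to `Q`. Its velocity and its chord
  -- each differ from `A (Q - P)` by at most `δ ‖Q - P‖ ≤ δ K ‖q - p‖`, and the two errors must add
  -- up to at most `ε ‖q - p‖`. The `+ 1` covers `K = 0`.
  set δ : ℝ := ε / (2 * (K + 1)) with hδ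
  have hδ0 : 0 < δ := by positivity
  have hcont : ContinuousAt (fderiv ℝ Φ.symm) (Φ x) :=
    (hΨx.fderiv_right (m := 0) (by norm_num)).continuousAt
  have hev : ∀ᶠ Q in 𝓝 (Φ x), Q ∈ Φ.target ∧ ‖fderiv ℝ Φ.symm Q - A‖ < δ := by
    refine (Φ.open_target.eventually_mem hxt).and ?_
    have := hcont.eventually (Metric.ball_mem_nhds _ hδ0)
    simpa [dist_eq_norm] using this
  obtain ⟨ρ, hρ, hball⟩ := Metric.eventually_nhds_iff.1 hev
  have hev2 : ∀ᶠ p in 𝓝 x, p ∈ Φ.source ∧ p ∈ V ∧ Φ p ∈ Metric.ball (Φ x) ρ :=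
    (Φ.open_source.eventually_mem hxΦ).and ((eventually_mem_set.2 hV).and
      (hΦx.continuousAt.eventually (Metric.ball_mem_nhds _ hρ)))
  obtain ⟨r, hr, hr'⟩ := Metric.eventually_nhds_iff.1 hev2
  refine ⟨r, hr, fun p hp q hq hpr hqr => ?_⟩
  obtain ⟨hpΦ, hpV, hpρ⟩ := hr' hpr
  obtain ⟨hqΦ, hqV, hqρ⟩ := hr' hqr
  set P := Φ p
  set Q := Φ q
  have hseg (t) (ht : t ∈ Icc (0 : ℝ) 1) : P + t • (Q - P) ∈ Metric.ball (Φ x) ρ :=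
    (convex_ball (Φ x) ρ).add_smul_sub_mem hpρ hqρ ht
  have hder (t) (ht : t ∈ Icc (0 : ℝ) 1) :
      HasDerivWithinAt (fun t : ℝ => Φ.symm (P + t • (Q - P)))
        (fderiv ℝ Φ.symm (P + t • (Q - P)) (Q - P)) (Icc 0 1) t := by
    have h1 : HasFDerivAt Φ.symm (fderiv ℝ Φ.symm (P + t • (Q - P))) (P + t • (Q - P)) :=
      ((hΨ.contDiffAt (Φ.open_target.mem_nhds (hball (hseg t ht)).1)).differentiableAt
        (by simp)).hasFDerivAt
    have h2 : HasDerivAt (fun t : ℝ => P + t • (Q - P)) (Q - P) t := by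
      simpa using ((hasDerivAt_id t).smul_const (Q - P)).const_add P
    exact (h1.comp_hasDerivAt t h2).hasDerivWithinAt
  have hQP : ‖Q - P‖ ≤ K * ‖q - p‖ := by
    simpa [dist_eq_norm] using hK.dist_le_mul q hqV p hpV
  have hchord : ‖(q - p) - A (Q - P)‖ ≤ δ * ‖Q - P‖ := by
    have h := Convex.norm_image_sub_le_of_norm_hasDerivWithin_le
      (f := fun t : ℝ => Φ.symm (P + t • (Q - P)) - t • A (Q - P))
      (fun t ht => (hder t ht).sub ((hasDerivWithinAt_id t (Icc (0 : ℝ) 1)).smul_const _))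
      (C := δ * ‖Q - P‖) (fun t ht => ?_) (convex_Icc (0 : ℝ) 1)
      (show (0 : ℝ) ∈ Icc (0 : ℝ) 1 by simp) (show (1 : ℝ) ∈ Icc (0 : ℝ) 1 by simp)
    · simpa [P, Q, Φ.left_inv hpΦ, Φ.left_inv hqΦ, sub_right_comm] using h
    · rw [one_smul, ← sub_apply]
      exact ContinuousLinearMap.le_of_opNorm_le _ (hball (hseg t ht)).2.le _
  have hspeed (t) (ht : t ∈ Icc (0 : ℝ) 1) :
      ‖fderiv ℝ Φ.symm (P + t • (Q - P)) (Q - P)‖ ≤ (1 + ε) * ‖q - p‖ := by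
    have h1 : ‖fderiv ℝ Φ.symm (P + t • (Q - P)) (Q - P) - A (Q - P)‖ ≤ δ * ‖Q - P‖ := by
      rw [← sub_apply]
      exact ContinuousLinearMap.le_of_opNorm_le _ (hball (hseg t ht)).2.le _
    have h2 : ‖fderiv ℝ Φ.symm (P + t • (Q - P)) (Q - P)‖ ≤
        ‖q - p‖ + ‖fderiv ℝ Φ.symm (P + t • (Q - P)) (Q - P) - A (Q - P)‖
          + ‖(q - p) - A (Q - P)‖ := by
      have := norm_add₃_le (a := q - p)
        (b := fderiv ℝ Φ.symm (P + t • (Q - P)) (Q - P) - A (Q - P))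
        (c := -((q - p) - A (Q - P)))
      rw [norm_neg] at this
      rwa [show q - p + (fderiv ℝ Φ.symm (P + t • (Q - P)) (Q - P) - A (Q - P)) +
        -((q - p) - A (Q - P)) = fderiv ℝ Φ.symm (P + t • (Q - P)) (Q - P) by abel] at this
    have h3 : 2 * (δ * ‖Q - P‖) ≤ ε * ‖q - p‖ := by
      have hK0 : (0 : ℝ) ≤ K := K.2
      calc 2 * (δ * ‖Q - P‖) ≤ 2 * (δ * ((K + 1) * ‖q - p‖)) := by
            gcongr
            nlinarith [norm_nonneg (q - p)]
        _ = ε * ‖q - p‖ := by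
            rw [hδ]
            field_simp
    linarith
  have hfinal := surfaceEDist_le_of_norm_derivWithin_le (S := S) zero_le_one
    (c := fun t : ℝ => Φ.symm (P + t • (Q - P))) (v := (1 + ε) * ‖q - p‖) ?_ ?_ ?_
  · simpa [P, Q, Φ.left_inv hpΦ, Φ.left_inv hqΦ] using hfinal
  · refine (hΨ.of_le (by norm_cast)).comp (ContDiff.contDiffOn (by fun_prop)) ?_
    exact fun t ht => (hball (hseg t ht)).1
  · intro t ht
    have htt := (hball (hseg t ht)).1
    rw [hiff _ (Φ.map_target htt), Φ.right_inv htt]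
    exact lineMap_apply_two_eq_zero ((hiff p hpΦ).1 hp) ((hiff q hqΦ).1 hq) t
  · intro t ht
    rw [(hder t ht).derivWithin (uniqueDiffOn_Icc one_pos t ht)]
    exact hspeed t ht

end CutLocus

end

/-! ### First variation inequality -/

noncomputable section

namespace CutLocus

section FirstVariation

variable {n : WithTop ℕ∞} {S : Set E3} {b x : E3} {γ : ℝ → E3}

lemma IsUnitSpeedMinGeodesic.surfaceDist_pos (h : IsUnitSpeedMinGeodesic S b x γ) :
    0 < surfaceDist S b x := by
  have h0 : 0 ≤ surfaceDist S b x := ENNReal.toReal_nonneg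
  refine h0.lt_of_ne fun h0' => ?_
  have h1 := h.2.1 _ ⟨h0, le_rfl⟩
  -- If the distance were `0`, the domain would be `{0}`, where `derivWithin` takes its default
  -- value `0`, against unit speed.
  have hacc : ¬ AccPt (0 : ℝ) (𝓟 {0}) := by
    rw [accPt_iff_frequently]
    simp
  simp [velocity, ← h0', derivWithin_zero_of_not_accPt hacc] at h1

/-- Initial arcs of a unit-speed geodesic bound the distance to its origin. -/
lemma IsUnitSpeedMinGeodesic.surfaceEDist_le (h : IsUnitSpeedMinGeodesic S b x γ) {s : ℝ}
    (hs : 0 < s) (hsL : s ≤ surfaceDist S b x) :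
    surfaceEDist S b (γ s) ≤ ENNReal.ofReal s := by
  have hsub : Icc 0 s ⊆ Icc 0 (surfaceDist S b x) := Icc_subset_Icc_right hsL
  have hle := surfaceEDist_le_of_norm_derivWithin_le (S := S) (c := γ) (v := 1) hs.le
    ((h.1.1.mono hsub).of_le (by norm_num)) (fun t ht => (h.1.2 t (hsub ht)).1) (fun t ht => by
      rw [((h.1.hasDerivWithinAt (hsub ht)).mono hsub).derivWithin (uniqueDiffOn_Icc hs t ht)]
      exact (h.2.1 t (hsub ht)).le)
  simpa [h.2.2.1] using hle

/-- The exponential map either takes its default value, or it is the end point of a geodesic. -/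
lemma expMap_eq_self_or (S : Set E3) (x w : E3) : expMap S x w = x ∨
    ∃ c : ℝ → E3, IsGeodesic S 1 c ∧ c 0 = x ∧ velocity 1 c 0 = w ∧ expMap S x w = c 1 := by
  by_cases h : ∃ c : ℝ → E3, IsGeodesic S 1 c ∧ c 0 = x ∧ velocity 1 c 0 = w
  · refine Or.inr ⟨h.choose, h.choose_spec.1, h.choose_spec.2.1, h.choose_spec.2.2, ?_⟩
    rw [expMap, dif_pos h]
  · left
    rw [expMap, dif_neg h]

/-- If `⟪u, v⟫ < a`, then for a suitable `K` the segment from `-K u` to `v` is shorter than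
`K + a`. -/
lemma exists_norm_smul_add_lt {u v : E3} (hu : ‖u‖ = 1) (hv : ‖v‖ = 1) {a : ℝ} (ha : 0 < a)
    (huv : inner ℝ u v < a) : ∃ K > 0, ‖K • u + v‖ < K + a := by
  have hpos : 0 < a - inner ℝ u v := sub_pos.2 huv
  -- In general `(K + a) ^ 2 - ‖K u + v‖ ^ 2 = 2 K (a - ⟪u, v⟫) + a ^ 2 - 1`; this `K` makes it `a ^
  -- 2`.
  refine ⟨1 / (2 * (a - inner ℝ u v)), by positivity, ?_⟩
  set K := 1 / (2 * (a - inner ℝ u v)) with hK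
  have hK0 : 0 < K := by positivity
  have h1 : 2 * K * (a - inner ℝ u v) = 1 := by rw [hK]; field_simp
  refine lt_of_pow_lt_pow_left₀ 2 (by positivity) ?_
  rw [norm_add_sq_real, norm_smul, inner_smul_left, hu, hv, Real.norm_of_nonneg hK0.le]
  simp only [conj_trivial]
  nlinarith [sq_pos_of_pos ha]

/-- First variation inequality: along the exponential map in the direction `v`, the distance to
`b` grows at a rate at most any positive `a` exceeding the inner product of `v` with the final
velocity of `γ`. -/
lemma IsUnitSpeedMinGeodesic.eventually_quotient_le (hn : ∞ ≤ n) (hS : IsSurface n S)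
    (hx : x ∈ S) (h : IsUnitSpeedMinGeodesic S b x γ) {v : E3} (hv : ‖v‖ = 1) {a : ℝ}
    (ha : 0 < a)
    (hva : inner ℝ (velocity (surfaceDist S b x) γ (surfaceDist S b x)) v < a) :
    ∀ᶠ t in 𝓝[>] (0 : ℝ),
      (surfaceDist S b (expMap S x (t • v)) - surfaceDist S b x) / t ≤ a := by
  have hL : 0 < surfaceDist S b x := h.surfaceDist_pos
  set L := surfaceDist S b x with hLdef
  have hLL : L ∈ Icc 0 L := ⟨hL.le, le_rfl⟩
  set u := velocity L γ L with hu
  have hγL : γ L = x := h.2.2.2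
  obtain ⟨K, hK, hKN⟩ := exists_norm_smul_add_lt (h.2.1 L hLL) hv ha hva
  set N := ‖K • u + v‖ with hN
  -- The strict gap between `N` and `K + a` absorbs the factor `1 + ε` of the chordal comparison and
  -- the errors `ε t` at the two ends of the chord.
  obtain ⟨ε, hε, hεN⟩ : ∃ ε > 0, (1 + ε) * (N + 2 * ε) < K + a := by
    have hc : ContinuousAt (fun ε : ℝ => (1 + ε) * (N + 2 * ε)) 0 := by fun_prop
    have hlt := hc.eventually_lt continuousAt_const (show _ < K + a by simpa using hKN)
    obtain ⟨ε, hε⟩ := ((hlt.filter_mono nhdsWithin_le_nhds).and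
      (self_mem_nhdsWithin (s := Ioi (0 : ℝ)))).exists
    exact ⟨ε, hε.2, hε.1⟩
  obtain ⟨C, hC, r, hr, hgeo⟩ := hS.exists_norm_geodesic_sub_le hn hx
  obtain ⟨ρ, hρ, hdist⟩ := hS.eventually_surfaceEDist_le hn hx hε
  have hsmall {m M : ℝ} (hM : 0 < M) : ∀ᶠ t in 𝓝[>] (0 : ℝ), m * t < M := by
    have hc : ContinuousAt (fun t : ℝ => m * t) 0 := by fun_prop
    exact (hc.eventually_lt continuousAt_const (show _ < M by simpa using hM)).filter_mono
      nhdsWithin_le_nhds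
  have hback : ∀ᶠ t in 𝓝[>] (0 : ℝ), ‖γ (L - K * t) - x + (K * t) • u‖ ≤ ε * t := by
    have hd := hasDerivWithinAt_iff_isLittleO.1 (h.1.hasDerivWithinAt hLL)
    have htend : Tendsto (fun t : ℝ => L - K * t) (𝓝[>] 0) (𝓝[Icc 0 L] L) := by
      refine tendsto_nhdsWithin_iff.2 ⟨?_, ?_⟩
      · have hc : ContinuousAt (fun t : ℝ => L - K * t) 0 := by fun_prop
        simpa using hc.tendsto.mono_left (nhdsWithin_le_nhds (s := Ioi (0 : ℝ)))
      · filter_upwards [hsmall (m := K) hL, self_mem_nhdsWithin] with t ht ht0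
        have : 0 < K * t := mul_pos hK ht0
        exact ⟨by linarith, by linarith⟩
    filter_upwards [htend.eventually (hd.def (div_pos hε hK)), self_mem_nhdsWithin] with t ht ht0
    have ht0' : 0 < K * t := mul_pos hK ht0
    rw [hγL, show L - K * t - L = -(K * t) by ring, neg_smul, sub_neg_eq_add, norm_neg,
      Real.norm_of_nonneg ht0'.le] at ht
    refine ht.trans (le_of_eq ?_)
    field_simp
  filter_upwards [hback, self_mem_nhdsWithin, hsmall (m := K) hL, hsmall (m := C) hε,
    hsmall (m := 1) hr, hsmall (m := K + ε) hρ, hsmall (m := 1 + ε) hρ]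
    with t hback ht0 htL htC htr htρ htρ'
  replace ht0 : 0 < t := ht0
  rcases expMap_eq_self_or S x (t • v) with hexp | ⟨c, hc, hc0, hcv, hexp⟩
  -- At the default value `x` the quotient is `0`; this is where `0 < a` is used for the exponential
  -- map.
  · rw [hexp, ← hLdef, sub_self, zero_div]
    exact ha.le
  set y := c 1 with hy
  have hyS : y ∈ S := (hc.2 1 (by simp)).1
  have hnv : ‖t • v‖ = t := by rw [norm_smul, hv, mul_one, Real.norm_of_nonneg ht0.le]
  have hyx : ‖y - x - t • v‖ ≤ ε * t := by
    have h1 := hgeo c hc hc0 (by rw [hcv, hnv]; linarith)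
    rw [hcv, hnv] at h1
    nlinarith
  set z := γ (L - K * t) with hz
  have hKt : 0 < K * t := mul_pos hK ht0
  have hzS : z ∈ S := (h.1.2 _ ⟨by linarith, by linarith⟩).1
  have hnu : ‖(K * t) • u‖ = K * t := by
    rw [norm_smul, h.2.1 L hLL, mul_one, Real.norm_of_nonneg hKt.le]
  have hzρ : dist z x < ρ := by
    rw [dist_eq_norm, show z - x = (z - x + (K * t) • u) - (K * t) • u by abel]
    refine (norm_sub_le _ _).trans_lt ?_
    rw [hnu]
    linarith
  have hyρ : dist y x < ρ := by
    rw [dist_eq_norm, show y - x = (y - x - t • v) + t • v by abel]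
    refine (norm_add_le _ _).trans_lt ?_
    rw [hnv]
    linarith
  have hyz : ‖y - z‖ ≤ t * (N + 2 * ε) := by
    have hsplit : y - z = t • (K • u + v) + (y - x - t • v) - (z - x + (K * t) • u) := by
      rw [smul_add, smul_smul, mul_comm t K]
      abel
    have h1 : ‖t • (K • u + v)‖ = t * N := by rw [norm_smul, Real.norm_of_nonneg ht0.le]
    rw [hsplit]
    refine (norm_sub_le _ _).trans ((add_le_add_left (norm_add_le _ _) _).trans ?_)
    rw [h1]
    linarith
  -- Follow `γ` to `z`, then go almost straight to `y`. By the choice of `ε` the total is below `L +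
  -- a t`.
  have hbound : surfaceEDist S b y ≤
      ENNReal.ofReal ((L - K * t) + (1 + ε) * (t * (N + 2 * ε))) := by
    rw [ENNReal.ofReal_add (by linarith) (by positivity)]
    refine (surfaceEDist_triangle S b z y).trans (add_le_add ?_ ?_)
    · exact h.surfaceEDist_le (by linarith) (by linarith)
    · refine (hdist z hzS y hyS hzρ hyρ).trans (ENNReal.ofReal_le_ofReal ?_)
      gcongr
  have hreal : surfaceDist S b y ≤ (L - K * t) + (1 + ε) * (t * (N + 2 * ε)) :=
    ENNReal.toReal_le_of_le_ofReal (add_nonneg (by linarith) (by positivity)) hbound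
  rw [hexp, div_le_iff₀ ht0]
  nlinarith

end FirstVariation

/-! ### Choice of the better geodesic and conclusion -/

/-- For unit vectors `u₁, u₂` at angle `θ`, every unit vector `v` has inner product at most
`cos (θ / 2)` with one of them. -/
lemma inner_le_cos_half_angle_or {u₁ u₂ v : E3} (h₁ : ‖u₁‖ = 1) (h₂ : ‖u₂‖ = 1) (hv : ‖v‖ = 1) :
    inner ℝ u₁ v ≤ Real.cos (InnerProductGeometry.angle u₁ u₂ / 2) ∨
      inner ℝ u₂ v ≤ Real.cos (InnerProductGeometry.angle u₁ u₂ / 2) := by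
  set θ := InnerProductGeometry.angle u₁ u₂ with hθ
  have hcos : 0 ≤ Real.cos (θ / 2) := Real.cos_nonneg_of_mem_Icc
    ⟨by linarith [InnerProductGeometry.angle_nonneg u₁ u₂, Real.pi_pos],
      by linarith [InnerProductGeometry.angle_le_pi u₁ u₂]⟩
  have hsum : ‖u₁ + u₂‖ = 2 * Real.cos (θ / 2) := by
    rw [← sq_eq_sq₀ (norm_nonneg _) (by positivity), norm_add_sq_real, h₁, h₂,
      ← InnerProductGeometry.cos_angle_mul_norm_mul_norm, h₁, h₂, ← hθ, mul_pow, Real.cos_sq,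
      mul_div_cancel₀ θ two_ne_zero]
    ring
  -- Otherwise `⟪u₁ + u₂, v⟫ > 2 cos (θ/2) = ‖u₁ + u₂‖`, against Cauchy–Schwarz.
  by_contra! hcon
  have hle := real_inner_le_norm (u₁ + u₂) v
  rw [inner_add_left, hsum, hv] at hle
  linarith [hcon.1, hcon.2]

end CutLocus

end

theorem mainTheorem5 (n : WithTop ℕ∞) (hn : ∞ ≤ n) (S : Set CutLocus.E3)
    (hS : CutLocus.IsSurface n S) (b : CutLocus.E3) (hb : b ∈ S)
    (x : CutLocus.E3) (hx : x ∈ CutLocus.cutLocus S b)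
    (γ₁ γ₂ : ℝ → CutLocus.E3)
    (h₁ : CutLocus.IsUnitSpeedMinGeodesic S b x γ₁)
    (h₂ : CutLocus.IsUnitSpeedMinGeodesic S b x γ₂)
    (θ : ℝ) (hθ : θ ∈ Set.Ioo 0 Real.pi)
    (hangle : θ = InnerProductGeometry.angle
      (-CutLocus.velocity (CutLocus.surfaceDist S b x) γ₁ (CutLocus.surfaceDist S b x))
      (-CutLocus.velocity (CutLocus.surfaceDist S b x) γ₂ (CutLocus.surfaceDist S b x))) :
    CutLocus.genGradNorm S (CutLocus.surfaceDist S b) x ≤ ((Real.cos (θ / 2) : ℝ) : EReal) := by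
  have hcos : 0 < Real.cos (θ / 2) :=
    Real.cos_pos_of_mem_Ioo ⟨by linarith [hθ.1, Real.pi_pos], by linarith [hθ.2]⟩
  refine max_le (by exact_mod_cast hcos.le) (iSup₂_le fun v hv => ?_)
  have hL : CutLocus.surfaceDist S b x ∈ Icc 0 (CutLocus.surfaceDist S b x) :=
    ⟨h₁.surfaceDist_pos.le, le_rfl⟩
  rw [InnerProductGeometry.angle_neg_neg] at hangle
  -- The first variation bound requires a strict inequality and a positive `a`, so it is applied to
  -- every real `a > cos (θ/2)`, positive because `θ < π`.
  refine EReal.le_of_forall_lt_iff_le.1 fun a ha => ?_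
  have ha' : Real.cos (θ / 2) < a := by exact_mod_cast ha
  have hev : ∀ᶠ t in 𝓝[>] (0 : ℝ), (CutLocus.surfaceDist S b (CutLocus.expMap S x (t • v)) -
      CutLocus.surfaceDist S b x) / t ≤ a := by
    -- Which geodesic serves depends on `v`.
    rcases CutLocus.inner_le_cos_half_angle_or (h₁.2.1 _ hL) (h₂.2.1 _ hL) hv.2 with h | h <;>
      rw [← hangle] at h
    · exact h₁.eventually_quotient_le hn hS hx.1 hv.2 (hcos.trans ha') (h.trans_lt ha')
    · exact h₂.eventually_quotient_le hn hS hx.1 hv.2 (hcos.trans ha') (h.trans_lt ha')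
  refine Filter.limsup_le_of_le (h := ?_)
  filter_upwards [hev] with t ht
  exact_mod_cast ht
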